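/- Let $G=(V,E)$ be a finite simple graph and $0<p\le 1$. A realization $G_p$ of $G$ keeps each edge of $G$ independently with probability $p$, and $\mathrm{OPT}(G)$ denotes the expected size of a maximum matching in $G_p$; for a subgraph $H$ of $G$, $\mathrm{OPT}(H)$ is defined in the same way. For $\varepsilon>0$, $\mathrm{MatchingCover}(G,\varepsilon)$ is the following procedure: for $i=1,\dots,R$, where $R=\left\lceil C\,\frac{\log(1/(\varepsilon p))}{\varepsilon p}\right\rceil$, let $M_i$ be a maximum matching of the graph $(V,E\setminus(M_1\cup\dots\cup M_{i-1}))$ (ties are broken arbitrarily); return $(M_1,\dots,M_R)$. There is an absolute constant $C_0>0$ such that the following holds for every constant $C\ge C_0$ in the number of rounds. Let $p_0>0$, let $p_0\le p\le 1$, and let $G=(V,E)$ be any finite simple graph. Let $M$ be any maximum matching of $G$, let $(M_1,\dots,M_R)$ be any result of $\mathrm{MatchingCover}\big((V,E\setminus M),\varepsilon\big)$ with $\varepsilon=p_0^2/10^4$, and let $H=(V,\,M\cup M_1\cup\dots\cup M_R)$. Then the expected maximum matching size of a realization $H_p$ of $H$ satisfies $$\mathrm{OPT}(H)\;\ge\;\Big(\frac12+\frac{p^2}{4}-\frac{p_0^2}{10^4}\Big)\cdot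 \mathrm{OPT}(G).$$ -/

import Mathlib

/-- `S` is (the edge set of) a matching of `G`. -/
def IsMatchingOf {V : Type*} (G : SimpleGraph V) (S : Set (Sym2 V)) : Prop :=
  ∃ N : G.Subgraph, N.IsMatching ∧ N.edgeSet = S

/-- `S` is a maximum (i.e. maximum-cardinality) matching of `G`. -/
def IsMaximumMatchingOf {V : Type*} (G : SimpleGraph V) (S : Set (Sym2 V)) : Prop :=
  IsMatchingOf G S ∧ ∀ T : Set (Sym2 V), IsMatchingOf G T → T.ncard ≤ S.ncard

/-- The maximum matching size of `G`. -/
noncomputable def maxMatchingSize {V : Type*} (G : SimpleGraph V) : ℕ :=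
  sSup {k : ℕ | ∃ S : Set (Sym2 V), IsMatchingOf G S ∧ S.ncard = k}

open scoped Classical in
/-- `opt(G)`: the expected maximum matching size of a realization `G_p` of `G`, in which each edge
of `G` is present independently with probability `p`. The set of realized edges equals
`F ⊆ E(G)` with probability `p ^ |F| * (1 - p) ^ |E(G) \ F|`. -/
noncomputable def expectedMatchingSize {V : Type*} [Fintype V] (G : SimpleGraph V) (p : ℝ) : ℝ :=
  ∑ F ∈ G.edgeFinset.powerset,
    p ^ F.card * (1 - p) ^ (G.edgeFinset \ F).card *
      (maxMatchingSize (SimpleGraph.fromEdgeSet (F : Set (Sym2 V))) : ℝ)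

/-- The number `R = Θ(log(1/(εp)) / (εp))` of rounds of `MatchingCover`, where `C` is the constant
hidden in the `Θ`. -/
noncomputable def matchingCoverRounds (C ε p : ℝ) : ℕ :=
  ⌈C * (Real.log (1 / (ε * p)) / (ε * p))⌉₊

/-- `(M 0, …, M (R - 1))` is a possible result of `R` rounds of `MatchingCover` on `G`: each
`M i` is a maximum matching of the graph that remains after the edges of all earlier matchings
have been removed. Ties between maximum matchings may be broken in any way. -/
def IsMatchingCover {V : Type*} (G : SimpleGraph V) (R : ℕ) (M : Fin R → Set (Sym2 V)) : Prop :=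
  ∀ i : Fin R, IsMaximumMatchingOf (G.deleteEdges (⋃ j : Fin R, ⋃ _ : j < i, M j)) (M i)

/-- `H` is a possible output of the algorithm on input `G` and `p`: `H` consists of the edges of
one maximum matching `M` of `G` and of the edges of a matching cover of `G(V, E \ M)`
with the parameter `ε = p₀ ^ 2 / 10 ^ 4`. -/
def IsAlgorithmOutput {V : Type*} (C p₀ p : ℝ) (G H : SimpleGraph V) : Prop :=
  ∃ (M : Set (Sym2 V))
    (N : Fin (matchingCoverRounds C (p₀ ^ 2 / 10 ^ 4) p) → Set (Sym2 V)),
    IsMaximumMatchingOf G M ∧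
    IsMatchingCover (G.deleteEdges M) (matchingCoverRounds C (p₀ ^ 2 / 10 ^ 4) p) N ∧
    H = SimpleGraph.fromEdgeSet (M ∪ ⋃ i, N i)

/-!
Let `Q` be the union of the matching cover, `m` the size of `M`, and `L` the size of a maximum
matching of the edges left over, so that every round of the cover has at least `L` edges. Then
`OPT(G) ≤ OPT(H) + L`. Moreover, an edge of a matching in the realization of `Q` can be added to the
realized edges of `M` unless one of the at most two edges of `M` that it meets is realized, so
`p * m + (1 - p) ^ 2 * OPT(Q) ≤ OPT(H)`. Balancing these two bounds gives the theorem, provided that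
`OPT(Q)` is at least `min L T - 2 * ε * T` for `T = OPT(G)`.

The bound on `OPT(Q)` is a union bound over graphs of Tutte-Berge form. Let `K` be a maximal graph
among those that contain a given realization of `Q` and have the same maximum matching size `ν`. A
vertex covered by all maximum matchings of `K` is adjacent to all others, and by Gallai's lemma
adjacency is transitive through the remaining vertices, so `K` is determined by the set of the
former and a spanning forest of the realization on the latter, which together have at most `4 * ν`
elements. If `ν < min L T - ε * T`, then every round has more than `ε * T` edges outside `K`, none
of which is realized, and with `R` rounds this is unlikely enough to pay for the number of
possible `K`.
-/

section Matching

variable {V : Type*} {G G' : SimpleGraph V} {S T : Set (Sym2 V)} {a b : V}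

lemma isMatchingOf_iff :
    IsMatchingOf G S ↔ S ⊆ G.edgeSet ∧ ∀ v, {e ∈ S | v ∈ e}.Subsingleton := by
  constructor
  · rintro ⟨N, hN, rfl⟩
    refine ⟨N.edgeSet_subset, fun v e ⟨he, hve⟩ f ⟨hf, hvf⟩ => ?_⟩
    obtain ⟨a, rfl⟩ := hve
    obtain ⟨b, rfl⟩ := hvf
    exact Sym2.congr_right.2 (hN.eq_of_adj_left (u := v) (v := a) (w := b) he hf)
  · rintro ⟨hSG, hS⟩
    let N : G.Subgraph :=
      { verts := {v | ∃ e ∈ S, v ∈ e}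
        Adj := fun a b => s(a, b) ∈ S
        adj_sub := fun h => hSG h
        edge_vert := fun h => ⟨_, h, Sym2.mem_mk_left _ _⟩
        symm := ⟨fun a b h => by rwa [Sym2.eq_swap]⟩ }
    refine ⟨N, ?_, Set.ext fun e => e.ind fun _ _ => Iff.rfl⟩
    rintro v ⟨_, he, a, rfl⟩
    exact ⟨a, he, fun b hb =>
      Sym2.congr_right.1 (hS v ⟨hb, Sym2.mem_mk_left v b⟩ ⟨he, Sym2.mem_mk_left v a⟩)⟩

lemma IsMatchingOf.subset_edgeSet (h : IsMatchingOf G S) : S ⊆ G.edgeSet :=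
  (isMatchingOf_iff.1 h).1

lemma IsMatchingOf.eq_of_mem (h : IsMatchingOf G S) {e f : Sym2 V} (he : e ∈ S) (hf : f ∈ S)
    {v : V} (hve : v ∈ e) (hvf : v ∈ f) : e = f :=
  (isMatchingOf_iff.1 h).2 v ⟨he, hve⟩ ⟨hf, hvf⟩

lemma IsMatchingOf.of_subset (h : IsMatchingOf G T) (hST : S ⊆ T) (hS : S ⊆ G'.edgeSet) :
    IsMatchingOf G' S :=
  isMatchingOf_iff.2 ⟨hS, fun v => ((isMatchingOf_iff.1 h).2 v).anti fun _ he => ⟨hST he.1, he.2⟩⟩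

lemma IsMatchingOf.subset (h : IsMatchingOf G T) (hST : S ⊆ T) : IsMatchingOf G S :=
  h.of_subset hST (hST.trans h.subset_edgeSet)

lemma IsMatchingOf.mono (h : IsMatchingOf G S) (hG : G ≤ G') : IsMatchingOf G' S :=
  h.of_subset Set.Subset.rfl (h.subset_edgeSet.trans (SimpleGraph.edgeSet_mono hG))

lemma isMatchingOf_empty (G : SimpleGraph V) : IsMatchingOf G ∅ :=
  isMatchingOf_iff.2 ⟨Set.empty_subset _, fun _ _ he => he.1.elim⟩

/-- The vertices that lie on some edge of `S`. -/
def coveredVertices (S : Set (Sym2 V)) : Set V := {v | ∃ e ∈ S, v ∈ e}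

lemma coveredVertices_mono (h : S ⊆ T) : coveredVertices S ⊆ coveredVertices T :=
  fun _ ⟨e, he, hve⟩ => ⟨e, h he, hve⟩

lemma notMem_of_notMem_coveredVertices (ha : a ∉ coveredVertices S) : s(a, b) ∉ S :=
  fun h => ha ⟨_, h, Sym2.mem_mk_left a b⟩

lemma coveredVertices_insert :
    coveredVertices (insert s(a, b) S) = {a, b} ∪ coveredVertices S := by
  ext v
  simp [coveredVertices]

lemma IsMatchingOf.notMem_coveredVertices_sdiff (h : IsMatchingOf G S) {e : Sym2 V} (he : e ∈ S)
    (hae : a ∈ e) : a ∉ coveredVertices (S \ {e}) :=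
  fun ⟨_, hf, haf⟩ => hf.2 (h.eq_of_mem hf.1 he haf hae)

lemma IsMatchingOf.union (hS : IsMatchingOf G S) (hT : IsMatchingOf G T)
    (hd : Disjoint (coveredVertices S) (coveredVertices T)) : IsMatchingOf G (S ∪ T) := by
  refine isMatchingOf_iff.2 ⟨Set.union_subset hS.subset_edgeSet hT.subset_edgeSet, fun v => ?_⟩
  rintro e ⟨he | he, hve⟩ f ⟨hf | hf, hvf⟩
  · exact hS.eq_of_mem he hf hve hvf
  · exact (Set.disjoint_left.1 hd ⟨e, he, hve⟩ ⟨f, hf, hvf⟩).elim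
  · exact (Set.disjoint_left.1 hd ⟨f, hf, hvf⟩ ⟨e, he, hve⟩).elim
  · exact hT.eq_of_mem he hf hve hvf

lemma IsMatchingOf.insert (h : IsMatchingOf G S) (hab : G.Adj a b)
    (ha : a ∉ coveredVertices S) (hb : b ∉ coveredVertices S) :
    IsMatchingOf G (insert s(a, b) S) := by
  have hedge : IsMatchingOf G {s(a, b)} :=
    isMatchingOf_iff.2 ⟨Set.singleton_subset_iff.2 hab,
      fun _ => Set.subsingleton_singleton.anti fun _ he => he.1⟩
  rw [Set.insert_eq]
  refine hedge.union h (Set.disjoint_left.2 ?_)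
  rintro v ⟨_, rfl, hv⟩
  rcases Sym2.mem_iff.1 hv with rfl | rfl
  exacts [ha, hb]

variable [Finite V]

lemma IsMatchingOf.ncard_coveredVertices (h : IsMatchingOf G S) :
    (coveredVertices S).ncard = 2 * S.ncard := by
  classical
  lift S to Finset (Sym2 V) using S.toFinite
  have hcov : coveredVertices (S : Set (Sym2 V)) = S.biUnion Sym2.toFinset := by
    ext v
    simp [coveredVertices]
  rw [hcov, Set.ncard_coe_finset, Set.ncard_coe_finset, Finset.card_biUnion, mul_comm]
  · exact Finset.sum_const_nat fun e he =>
      Sym2.card_toFinset_of_not_isDiag e (G.not_isDiag_of_mem_edgeSet (h.subset_edgeSet he))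
  · refine fun e he f hf hne => Finset.disjoint_left.2 fun v hve hvf => hne ?_
    exact h.eq_of_mem he hf (Sym2.mem_toFinset.1 hve) (Sym2.mem_toFinset.1 hvf)

lemma bddAbove_ncard_isMatchingOf (G : SimpleGraph V) :
    BddAbove {k | ∃ S, IsMatchingOf G S ∧ S.ncard = k} := by
  refine ⟨Nat.card (Sym2 V), ?_⟩
  rintro k ⟨S, -, rfl⟩
  exact Set.ncard_le_card S

lemma IsMatchingOf.ncard_le (h : IsMatchingOf G S) : S.ncard ≤ maxMatchingSize G :=
  le_csSup (bddAbove_ncard_isMatchingOf G) ⟨S, h, rfl⟩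

lemma exists_isMatchingOf_ncard_eq (G : SimpleGraph V) :
    ∃ S, IsMatchingOf G S ∧ S.ncard = maxMatchingSize G := by
  have hne : {k | ∃ S, IsMatchingOf G S ∧ S.ncard = k}.Nonempty :=
    ⟨0, ∅, isMatchingOf_empty G, Set.ncard_empty _⟩
  exact Nat.sSup_mem hne (bddAbove_ncard_isMatchingOf G)

lemma isMaximumMatchingOf_iff :
    IsMaximumMatchingOf G S ↔ IsMatchingOf G S ∧ S.ncard = maxMatchingSize G := by
  refine and_congr_right fun hS => ⟨fun hmax => ?_, fun h T hT => h ▸ hT.ncard_le⟩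
  obtain ⟨T, hT, hcard⟩ := exists_isMatchingOf_ncard_eq G
  exact hS.ncard_le.antisymm (hcard ▸ hmax T hT)

lemma IsMaximumMatchingOf.ncard_eq (h : IsMaximumMatchingOf G S) :
    S.ncard = maxMatchingSize G :=
  (isMaximumMatchingOf_iff.1 h).2

lemma exists_isMaximumMatchingOf (G : SimpleGraph V) : ∃ S, IsMaximumMatchingOf G S :=
  (exists_isMatchingOf_ncard_eq G).imp fun _ => isMaximumMatchingOf_iff.2

lemma maxMatchingSize_mono (h : G ≤ G') : maxMatchingSize G ≤ maxMatchingSize G' := by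
  obtain ⟨S, hS⟩ := exists_isMaximumMatchingOf G
  exact hS.ncard_eq ▸ (hS.1.mono h).ncard_le

lemma IsMaximumMatchingOf.mem_coveredVertices_of_adj (h : IsMaximumMatchingOf G S)
    (hab : G.Adj a b) (ha : a ∉ coveredVertices S) : b ∈ coveredVertices S := by
  by_contra hb
  have hlt := h.2 _ (h.1.insert hab ha hb)
  rw [Set.ncard_insert_of_notMem (notMem_of_notMem_coveredVertices ha)] at hlt
  omega

lemma IsMaximumMatchingOf.exists_exchange (h : IsMaximumMatchingOf G S) (hab : G.Adj a b)
    (ha : a ∉ coveredVertices S) :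
    ∃ f ∈ S, b ∈ f ∧ IsMaximumMatchingOf G (insert s(a, b) (S \ {f})) := by
  obtain ⟨f, hf, hbf⟩ := h.mem_coveredVertices_of_adj hab ha
  have ha' : a ∉ coveredVertices (S \ {f}) :=
    fun h' => ha (coveredVertices_mono Set.sdiff_subset h')
  refine ⟨f, hf, hbf, isMaximumMatchingOf_iff.2
    ⟨(h.1.subset Set.sdiff_subset).insert hab ha' (h.1.notMem_coveredVertices_sdiff hf hbf), ?_⟩⟩
  rw [Set.ncard_insert_of_notMem (notMem_of_notMem_coveredVertices ha'),
    Set.ncard_sdiff_singleton_add_one hf, h.ncard_eq]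

end Matching

section Gallai

variable {V : Type*} {G : SimpleGraph V} {x y z : V}

/-- Some maximum matching of `G` covers neither `x` nor `y`; for `x = y` this says that `x` is not
essential. Its negation plays the role of the equivalence relation in Gallai's lemma. -/
def MissedTogether (G : SimpleGraph V) (x y : V) : Prop :=
  ∃ S, IsMaximumMatchingOf G S ∧ x ∉ coveredVertices S ∧ y ∉ coveredVertices S

variable [Finite V]

lemma MissedTogether.not_adj (h : MissedTogether G x y) : ¬G.Adj x y :=
  fun hxy => let ⟨_, hS, hx, hy⟩ := h; hy (hS.mem_coveredVertices_of_adj hxy hx)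

/- Gallai's lemma, in contrapositive form. -/
lemma MissedTogether.or_of_ne (hxz : x ≠ z) (h : MissedTogether G x z)
    (hy : MissedTogether G y y) : MissedTogether G x y ∨ MissedTogether G y z := by
  obtain ⟨M, hM, hxM, hzM⟩ := h
  -- Take `N` missing `y` that agrees with `M` as much as possible.
  obtain ⟨N, ⟨hN, hyN⟩, hmax⟩ := (Set.toFinite
    {S | IsMaximumMatchingOf G S ∧ y ∉ coveredVertices S}).exists_maximalFor
      (fun S => (M ∩ S).ncard) _ (let ⟨S, hS, hyS, _⟩ := hy; ⟨S, hS, hyS⟩)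
  by_contra! hcon
  have hxN : x ∈ coveredVertices N := not_not.1 fun hxN => hcon.1 ⟨N, hN, hxN, hyN⟩
  have hzN : z ∈ coveredVertices N := not_not.1 fun hzN => hcon.2 ⟨N, hN, hyN, hzN⟩
  obtain ⟨t, ⟨htM, htN⟩, hty⟩ : ∃ t ∈ coveredVertices M \ coveredVertices N, t ≠ y := by
    have hcard : (coveredVertices M \ coveredVertices N).ncard =
        (coveredVertices N \ coveredVertices M).ncard := by
      rw [← Set.ncard_eq_ncard_iff_ncard_sdiff_eq_ncard_sdiff, hM.1.ncard_coveredVertices,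
        hN.1.ncard_coveredVertices, hM.ncard_eq, hN.ncard_eq]
    refine Set.exists_ne_of_one_lt_ncard (hcard ▸ (Set.one_lt_ncard).2 ?_) y
    exact ⟨x, ⟨hxN, hxM⟩, z, ⟨hzN, hzM⟩, hxz⟩
  obtain ⟨_, hts, s, rfl⟩ := htM
  have hadj : G.Adj t s := hM.1.subset_edgeSet hts
  obtain ⟨f, hfN, hsf, hN'⟩ := hN.exists_exchange hadj htN
  have hfM : f ∉ M := fun hfM => notMem_of_notMem_coveredVertices htN
    (hM.1.eq_of_mem hfM hts hsf (Sym2.mem_mk_right t s) ▸ hfN)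
  have hyN' : y ∉ coveredVertices (insert s(t, s) (N \ {f})) := fun h => by
    rw [coveredVertices_insert] at h
    rcases h with (rfl | rfl) | h
    · exact hty rfl
    · exact hyN ⟨f, hfN, hsf⟩
    · exact hyN (coveredVertices_mono Set.sdiff_subset h)
  have hsub : insert s(t, s) (M ∩ N) ⊆ M ∩ insert s(t, s) (N \ {f}) := by
    refine Set.insert_subset ⟨hts, Set.mem_insert _ _⟩ fun g hg => ⟨hg.1, Or.inr ⟨hg.2, ?_⟩⟩
    rintro rfl
    exact hfM hg.1
  have hlt := Set.ncard_le_ncard hsub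
  rw [Set.ncard_insert_of_notMem fun h => notMem_of_notMem_coveredVertices htN h.2] at hlt
  exact Nat.not_le.2 hlt (hmax ⟨hN', hyN'⟩ ((Nat.le_succ _).trans hlt))

end Gallai

section Saturated

variable {V : Type*} {G K : SimpleGraph V} {a b x y z : V}

/-- Adding any edge to `K` increases the maximum matching size. These are the graphs in which the
Tutte-Berge structure is visible: a set of universal vertices together with disjoint cliques. -/
def IsSaturated (K : SimpleGraph V) : Prop :=
  ∀ ⦃a b : V⦄, a ≠ b → ¬K.Adj a b → maxMatchingSize K < maxMatchingSize (K ⊔ SimpleGraph.edge a b)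

/-- The vertices covered by every maximum matching of `K`. -/
def essentialVertices (K : SimpleGraph V) : Set V := {v | ¬MissedTogether K v v}

lemma mem_spanningCoe_induce_adj {s : Set V} :
    (G.induce s).spanningCoe.Adj a b ↔ G.Adj a b ∧ a ∈ s ∧ b ∈ s := by
  simp [SimpleGraph.map_adj]

lemma IsMaximumMatchingOf.essentialVertices_subset {S : Set (Sym2 V)}
    (hS : IsMaximumMatchingOf K S) : essentialVertices K ⊆ coveredVertices S :=
  fun _ hv => not_not.1 fun hvS => hv ⟨S, hS, hvS, hvS⟩

variable [Finite V]

lemma exists_isSaturated_ge (G : SimpleGraph V) :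
    ∃ K ≥ G, IsSaturated K ∧ maxMatchingSize K ≤ maxMatchingSize G := by
  have hfin : {K : SimpleGraph V | maxMatchingSize K ≤ maxMatchingSize G}.Finite := Set.toFinite _
  obtain ⟨K, hGK, hK⟩ := hfin.exists_le_maximal (le_refl (maxMatchingSize G))
  refine ⟨K, hGK, fun a b hab hadj => ?_, hK.prop⟩
  refine hK.prop.trans_lt (not_le.1 fun hle => hadj ?_)
  exact hK.le_of_ge hle le_sup_left (Or.inr ((SimpleGraph.edge_adj ..).2 ⟨Or.inl ⟨rfl, rfl⟩, hab⟩))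

lemma IsSaturated.missedTogether (hK : IsSaturated K) (hab : a ≠ b) (hadj : ¬K.Adj a b) :
    MissedTogether K a b := by
  obtain ⟨S, hS⟩ := exists_isMaximumMatchingOf (K ⊔ SimpleGraph.edge a b)
  have hlt : maxMatchingSize K < S.ncard := hS.ncard_eq ▸ hK hab hadj
  have hsub : S \ {s(a, b)} ⊆ K.edgeSet := by
    rw [Set.sdiff_subset_iff, Set.union_comm, ← SimpleGraph.edgeSet_edge_of_ne hab,
      ← SimpleGraph.edgeSet_sup]
    exact hS.1.subset_edgeSet
  have hmem : s(a, b) ∈ S := by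
    by_contra h
    rw [Set.sdiff_singleton_eq_self h] at hsub
    exact hlt.not_ge (hS.1.of_subset Set.Subset.rfl hsub).ncard_le
  have hmatch : IsMatchingOf K (S \ {s(a, b)}) := hS.1.of_subset Set.sdiff_subset hsub
  refine ⟨_, isMaximumMatchingOf_iff.2 ⟨hmatch, hmatch.ncard_le.antisymm ?_⟩,
    hS.1.notMem_coveredVertices_sdiff hmem (Sym2.mem_mk_left a b),
    hS.1.notMem_coveredVertices_sdiff hmem (Sym2.mem_mk_right a b)⟩
  have := Set.ncard_sdiff_singleton_add_one hmem
  omega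

lemma IsSaturated.adj_of_mem_essentialVertices (hK : IsSaturated K) (ha : a ∈ essentialVertices K)
    (hab : a ≠ b) : K.Adj a b := by
  by_contra hadj
  obtain ⟨S, hS, haS, -⟩ := hK.missedTogether hab hadj
  exact ha ⟨S, hS, haS, haS⟩

lemma IsSaturated.adj_trans (hK : IsSaturated K) (hy : y ∉ essentialVertices K) (hxz : x ≠ z)
    (hxy : K.Adj x y) (hyz : K.Adj y z) : K.Adj x z := by
  by_contra hadj
  rcases (hK.missedTogether hxz hadj).or_of_ne hxz (not_not.1 hy) with h | h
  exacts [h.not_adj hxy, h.not_adj hyz]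

lemma IsSaturated.eq_or_adj_of_reachable (hK : IsSaturated K)
    (hxy : (K.induce (essentialVertices K)ᶜ).spanningCoe.Reachable x y) : x = y ∨ K.Adj x y := by
  obtain ⟨w⟩ := hxy
  induction w with
  | nil => exact Or.inl rfl
  | @cons x u y h _ ih =>
    obtain ⟨hxu, -, hu⟩ := mem_spanningCoe_induce_adj.1 h
    rcases ih with rfl | huy
    · exact Or.inr hxu
    · exact or_iff_not_imp_left.2 fun hne => hK.adj_trans hu hne hxu huy

lemma ncard_essentialVertices_le (K : SimpleGraph V) :
    (essentialVertices K).ncard ≤ 2 * maxMatchingSize K := by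
  obtain ⟨S, hS⟩ := exists_isMaximumMatchingOf K
  rw [← hS.ncard_eq, ← hS.1.ncard_coveredVertices]
  exact Set.ncard_le_ncard hS.essentialVertices_subset

end Saturated

section CoverGraph

variable {V : Type*} {G K F : SimpleGraph V} {U U' : Set V} {a b : V}

/-- The graph obtained from the connected components of `F` by completing each of them to a clique
and joining every vertex of `U` to all other vertices. By the Tutte-Berge formula every graph is
contained in such a graph with the same maximum matching size, where `U` and `F` are small. -/
def coverGraph (U : Set V) (F : SimpleGraph V) : SimpleGraph V :=
  SimpleGraph.fromRel fun a b => a ∈ U ∨ F.Reachable a b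

lemma coverGraph_adj :
    (coverGraph U F).Adj a b ↔ a ≠ b ∧ (a ∈ U ∨ b ∈ U ∨ F.Reachable a b) := by
  rw [coverGraph, SimpleGraph.fromRel_adj, SimpleGraph.reachable_comm (u := b)]
  tauto

lemma coverGraph_mono (h : U ⊆ U') : coverGraph U F ≤ coverGraph U' F := fun a b hab => by
  rw [coverGraph_adj] at hab ⊢
  exact ⟨hab.1, hab.2.imp (@h a) (Or.imp_left (@h b))⟩

lemma le_coverGraph (hF : (G.induce Uᶜ).spanningCoe.Reachable ≤ F.Reachable) :
    G ≤ coverGraph (U ∩ G.support) F := fun a b hab => by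
  refine coverGraph_adj.2 ⟨hab.ne, ?_⟩
  by_cases ha : a ∈ U
  · exact Or.inl ⟨ha, b, hab⟩
  by_cases hb : b ∈ U
  · exact Or.inr (Or.inl ⟨hb, a, hab.symm⟩)
  · exact Or.inr (Or.inr (hF a b (mem_spanningCoe_induce_adj.2 ⟨hab, ha, hb⟩).reachable))

variable [Finite V]

/- Deleting an edge of `F` separates its endpoints, so one of them can be added to `W`. -/
lemma ncard_edgeSet_add_ncard_le_of_isAcyclic {F : SimpleGraph V} (hF : F.IsAcyclic) {W : Set V}
    (hW : W.Pairwise fun x y => ¬F.Reachable x y) : F.edgeSet.ncard + W.ncard ≤ Nat.card V := by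
  induction hn : F.edgeSet.ncard generalizing F W with
  | zero => simpa using Set.ncard_le_card W
  | succ n ih =>
    obtain ⟨e, he⟩ : F.edgeSet.Nonempty := Set.nonempty_of_ncard_ne_zero (by omega)
    induction e with | h u v => ?_
    have huv : F.Adj u v := he
    have hbridge : ¬(F.deleteEdges {s(u, v)}).Reachable u v :=
      SimpleGraph.isAcyclic_iff_forall_isBridge.1 hF he
    set F' := F.deleteEdges {s(u, v)}
    have hF'F : F' ≤ F := F.deleteEdges_le _
    obtain ⟨x, hx⟩ : ∃ x, ∀ w ∈ W, ¬F'.Reachable x w := by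
      by_contra! h
      obtain ⟨w, hw, huw⟩ := h u
      obtain ⟨w', hw', hvw'⟩ := h v
      rcases eq_or_ne w w' with rfl | hne
      · exact hbridge (huw.trans hvw'.symm)
      · exact hW hw hw' hne
          ((huw.mono hF'F).symm.trans (huv.reachable.trans (hvw'.mono hF'F)))
    have hxW : x ∉ W := fun h => hx x h .rfl
    have hcard : F'.edgeSet.ncard = n := by
      have := Set.ncard_sdiff_singleton_add_one he
      rw [SimpleGraph.edgeSet_deleteEdges]
      omega
    have := ih (hF.anti hF'F) (W := insert x W) (Set.Pairwise.insert
      (hW.imp fun _ _ h h' => h (h'.mono hF'F))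
      fun w hw _ => ⟨hx w hw, fun h => hx w hw h.symm⟩) hcard
    rw [Set.ncard_insert_of_notMem hxW] at this
    omega

lemma IsSaturated.coverGraph_le (hK : IsSaturated K)
    (hF : F ≤ (K.induce (essentialVertices K)ᶜ).spanningCoe) :
    coverGraph (essentialVertices K) F ≤ K := fun a b hab => by
  obtain ⟨hne, ha | hb | h⟩ := coverGraph_adj.1 hab
  · exact hK.adj_of_mem_essentialVertices ha hne
  · exact (hK.adj_of_mem_essentialVertices hb hne.symm).symm
  · exact (hK.eq_or_adj_of_reachable (h.mono hF)).resolve_left hne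

lemma IsSaturated.ncard_edgeSet_le (hK : IsSaturated K)
    (hF : F ≤ (K.induce (essentialVertices K)ᶜ).spanningCoe) (hacyc : F.IsAcyclic) :
    F.edgeSet.ncard ≤ 2 * maxMatchingSize K := by
  obtain ⟨S, hS⟩ := exists_isMaximumMatchingOf K
  have hW : (coveredVertices S)ᶜ.Pairwise fun x y => ¬F.Reachable x y := fun x hx y hy hne h =>
    hy (hS.mem_coveredVertices_of_adj
      ((hK.eq_or_adj_of_reachable (h.mono hF)).resolve_left hne) hx)
  have hle := ncard_edgeSet_add_ncard_le_of_isAcyclic hacyc hW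
  rw [← Set.ncard_add_ncard_compl (coveredVertices S), hS.1.ncard_coveredVertices,
    hS.ncard_eq] at hle
  omega

lemma exists_coverGraph (G : SimpleGraph V) :
    ∃ U ⊆ G.support, ∃ F ≤ G, U.ncard + F.edgeSet.ncard ≤ 4 * maxMatchingSize G ∧
      G ≤ coverGraph U F ∧ maxMatchingSize (coverGraph U F) ≤ maxMatchingSize G := by
  obtain ⟨K, hGK, hK, hle⟩ := exists_isSaturated_ge G
  set U := essentialVertices K
  obtain ⟨F, hFG, hF, hreach⟩ := (G.induce Uᶜ).spanningCoe.exists_isAcyclic_reachable_eq_le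
  have hFK : F ≤ (K.induce Uᶜ).spanningCoe := fun a b hab =>
    mem_spanningCoe_induce_adj.2 ((mem_spanningCoe_induce_adj.1 (hFG hab)).imp_left (@hGK a b))
  refine ⟨U ∩ G.support, Set.inter_subset_right, F,
    hFG.trans (SimpleGraph.spanningCoe_induce_le G _), ?_, le_coverGraph hreach.ge,
    (maxMatchingSize_mono ((coverGraph_mono Set.inter_subset_left).trans
      (hK.coverGraph_le hFK))).trans hle⟩
  have hU : (U ∩ G.support).ncard ≤ 2 * maxMatchingSize K :=
    (Set.ncard_le_ncard Set.inter_subset_left).trans (ncard_essentialVertices_le K)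
  have := hK.ncard_edgeSet_le hFK hF
  omega

end CoverGraph

open Finset

section RandomSubset

variable {α : Type*} [DecidableEq α] {p : ℝ} {E : Finset α} {f g : Finset α → ℝ}

/-- The expectation of `f F` for the random subset `F` of `E` that contains each element of `E`
independently with probability `p`. -/
noncomputable def randomSubsetMean (p : ℝ) (E : Finset α) : (Finset α → ℝ) →ₗ[ℝ] ℝ :=
  ∑ F ∈ E.powerset, (p ^ #F * (1 - p) ^ #(E \ F)) • LinearMap.proj F

open scoped Classical in
/-- The probability that `P F` holds for the random subset `F` of `E` that contains each element of
`E` independently with probability `p`. -/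
noncomputable def randomSubsetProb (p : ℝ) (E : Finset α) (P : Finset α → Prop) : ℝ :=
  randomSubsetMean p E fun F => if P F then 1 else 0

lemma randomSubsetProb_eq (p : ℝ) (E : Finset α) (P : Finset α → Prop) [DecidablePred P] :
    randomSubsetProb p E P = randomSubsetMean p E fun F => if P F then 1 else 0 := by
  unfold randomSubsetProb
  congr!

lemma randomSubsetMean_apply (p : ℝ) (E : Finset α) (f : Finset α → ℝ) :
    randomSubsetMean p E f = ∑ F ∈ E.powerset, p ^ #F * (1 - p) ^ #(E \ F) * f F := by
  simp [randomSubsetMean]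

lemma randomSubsetMean_empty : randomSubsetMean p ∅ f = f ∅ := by
  simp [randomSubsetMean_apply]

lemma randomSubsetMean_insert {a : α} (ha : a ∉ E) (f : Finset α → ℝ) :
    randomSubsetMean p (insert a E) f =
      (1 - p) * randomSubsetMean p E f + p * randomSubsetMean p E fun F => f (insert a F) := by
  simp only [randomSubsetMean_apply, sum_powerset_insert ha, mul_sum]
  congr 1 <;> refine sum_congr rfl fun F hF => ?_
  all_goals have haF : a ∉ F := fun h => ha (mem_powerset.1 hF h)
  · rw [insert_sdiff_of_notMem _ haF, card_insert_of_notMem (by simp [ha])]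
    ring
  · rw [insert_sdiff_insert, sdiff_insert_of_notMem ha, card_insert_of_notMem haF]
    ring

lemma randomSubsetMean_mono (hp : 0 ≤ p) (hp1 : p ≤ 1) (h : ∀ F ⊆ E, f F ≤ g F) :
    randomSubsetMean p E f ≤ randomSubsetMean p E g := by
  have : 0 ≤ 1 - p := sub_nonneg.2 hp1
  simp only [randomSubsetMean_apply]
  gcongr with F hF
  exact h F (mem_powerset.1 hF)

lemma randomSubsetMean_nonneg (hp : 0 ≤ p) (hp1 : p ≤ 1) (h : ∀ F ⊆ E, 0 ≤ f F) :
    0 ≤ randomSubsetMean p E f := by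
  simpa using randomSubsetMean_mono (f := 0) hp hp1 h

lemma randomSubsetMean_const (c : ℝ) : (randomSubsetMean p E fun _ => c) = c := by
  induction E using Finset.induction_on with
  | empty => exact randomSubsetMean_empty
  | insert a E ha ih => rw [randomSubsetMean_insert ha, ih]; ring

lemma randomSubsetMean_union {A B : Finset α} (hAB : Disjoint A B) (f : Finset α → ℝ) :
    randomSubsetMean p (A ∪ B) f =
      randomSubsetMean p A fun F₁ => randomSubsetMean p B fun F₂ => f (F₁ ∪ F₂) := by
  induction A using Finset.induction_on generalizing f with
  | empty => simp [randomSubsetMean_empty]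
  | insert a A ha ih =>
    rw [disjoint_insert_left] at hAB
    rw [insert_union, randomSubsetMean_insert (by simp [ha, hAB.1]), randomSubsetMean_insert ha,
      ih hAB.2, ih hAB.2]
    simp only [insert_union]

lemma randomSubsetMean_card : (randomSubsetMean p E fun F => (#F : ℝ)) = p * #E := by
  induction E using Finset.induction_on with
  | empty => simp [randomSubsetMean_empty]
  | insert a E ha ih =>
    have hinsert : (randomSubsetMean p E fun F => (#(insert a F) : ℝ)) =
        randomSubsetMean p E fun F => (#F : ℝ) + 1 := by
      simp only [randomSubsetMean_apply]
      refine sum_congr rfl fun F hF => ?_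
      rw [card_insert_of_notMem fun h => ha (mem_powerset.1 hF h), Nat.cast_add_one]
    have hadd : (randomSubsetMean p E fun F => (#F : ℝ) + 1) =
        (randomSubsetMean p E fun F => (#F : ℝ)) + randomSubsetMean p E fun _ => 1 :=
      map_add ..
    rw [randomSubsetMean_insert ha, hinsert, hadd, ih, randomSubsetMean_const,
      card_insert_of_notMem ha]
    push_cast
    ring

lemma randomSubsetProb_insert {a : α} (ha : a ∉ E) (P : Finset α → Prop) :
    randomSubsetProb p (insert a E) P =
      (1 - p) * randomSubsetProb p E P + p * randomSubsetProb p E fun F => P (insert a F) :=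
  randomSubsetMean_insert ha _

lemma randomSubsetProb_false : (randomSubsetProb p E fun _ => False) = 0 := by
  simp [randomSubsetProb, randomSubsetMean_const]

lemma randomSubsetProb_disjoint (B : Finset α) :
    randomSubsetProb p E (Disjoint · B) = (1 - p) ^ #(E ∩ B) := by
  induction E using Finset.induction_on with
  | empty => simp [randomSubsetProb, randomSubsetMean_empty]
  | insert a E ha ih =>
    rw [randomSubsetProb_insert ha, ih]
    by_cases haB : a ∈ B
    · simp [disjoint_insert_left, haB, randomSubsetProb_false, insert_inter_of_mem, ha, pow_succ']
    · simp only [disjoint_insert_left, haB, not_false_eq_true, true_and, insert_inter_of_notMem, ih]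
      ring

lemma randomSubsetProb_le_sum {ι : Type*} {I : Finset ι} {P : Finset α → Prop}
    {P' : ι → Finset α → Prop} (hp : 0 ≤ p) (hp1 : p ≤ 1)
    (h : ∀ F ⊆ E, P F → ∃ i ∈ I, P' i F) :
    randomSubsetProb p E P ≤ ∑ i ∈ I, randomSubsetProb p E (P' i) := by
  classical
  simp only [randomSubsetProb_eq, ← map_sum]
  refine randomSubsetMean_mono hp hp1 fun F hF => ?_
  rw [Finset.sum_apply]
  split_ifs with hPF
  · obtain ⟨i, hi, hiF⟩ := h F hF hPF
    exact (if_pos hiF).ge.trans (single_le_sum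
      (f := fun i => if P' i F then (1 : ℝ) else 0) (fun i _ => by positivity) hi)
  · exact sum_nonneg fun i _ => by positivity

lemma mul_one_sub_randomSubsetProb_lt_le (hp : 0 ≤ p) (hp1 : p ≤ 1) (hf : ∀ F ⊆ E, 0 ≤ f F)
    (a : ℝ) : a * (1 - randomSubsetProb p E (f · < a)) ≤ randomSubsetMean p E f := by
  calc a * (1 - randomSubsetProb p E (f · < a))
      = randomSubsetMean p E (a • ((fun _ => 1) - fun F => if f F < a then 1 else 0)) := by
        rw [map_smul, map_sub, randomSubsetMean_const, smul_eq_mul, randomSubsetProb_eq]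
    _ ≤ randomSubsetMean p E f := randomSubsetMean_mono hp hp1 fun F hF => ?_
  by_cases hfa : f F < a
  · simpa [hfa] using hf F hF
  · simpa [hfa] using not_lt.1 hfa

end RandomSubset

/- Chernoff's method: count `S` with weight `exp (t * (κ - #S))`, which is at least `1`. -/
lemma card_filter_powerset_card_le {α : Type*} (E : Finset α) (κ : ℝ) {t : ℝ} (ht : 0 ≤ t) :
    (#{S ∈ E.powerset | (#S : ℝ) ≤ κ} : ℝ) ≤ Real.exp (t * κ + Real.exp (-t) * #E) := by
  calc (#{S ∈ E.powerset | (#S : ℝ) ≤ κ} : ℝ)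
      = ∑ S ∈ E.powerset with (#S : ℝ) ≤ κ, 1 := by simp
    _ ≤ ∑ S ∈ E.powerset with (#S : ℝ) ≤ κ, Real.exp (t * κ) * Real.exp (-t) ^ #S := by
        refine sum_le_sum fun S hS => ?_
        rw [← Real.exp_nat_mul, ← Real.exp_add, Real.one_le_exp_iff]
        nlinarith [mul_le_mul_of_nonneg_left (mem_filter.1 hS).2 ht]
    _ ≤ ∑ S ∈ E.powerset, Real.exp (t * κ) * Real.exp (-t) ^ #S :=
        sum_le_sum_of_subset_of_nonneg (filter_subset _ _) fun _ _ _ => by positivity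
    _ = Real.exp (t * κ) * (Real.exp (-t) + 1) ^ #E := by
        rw [← mul_sum, ← sum_pow_mul_eq_add_pow]
        simp
    _ ≤ Real.exp (t * κ) * Real.exp (Real.exp (-t)) ^ #E := by
        gcongr
        exact Real.add_one_le_exp _
    _ = Real.exp (t * κ + Real.exp (-t) * #E) := by
        rw [← Real.exp_nat_mul, Real.exp_add, mul_comm (#E : ℝ)]

section MatchingNumber

variable {V : Type*} {E F F' S : Finset (Sym2 V)}

/-- The maximum matching size of the graph with edge set `F`. -/
noncomputable def matchingNumber (F : Finset (Sym2 V)) : ℕ :=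
  maxMatchingSize (SimpleGraph.fromEdgeSet (F : Set (Sym2 V)))

lemma isMatchingOf_fromEdgeSet_iff {S F : Set (Sym2 V)} :
    IsMatchingOf (SimpleGraph.fromEdgeSet F) S ↔ S ⊆ F ∧ IsMatchingOf ⊤ S := by
  refine ⟨fun h => ⟨?_, h.mono le_top⟩, fun ⟨hSF, hS⟩ => hS.of_subset Set.Subset.rfl ?_⟩
  · exact h.subset_edgeSet.trans (SimpleGraph.edgeSet_fromEdgeSet F ▸ Set.sdiff_subset)
  · rw [SimpleGraph.edgeSet_fromEdgeSet]
    exact fun e he => ⟨hSF he, SimpleGraph.not_isDiag_of_mem_edgeSet _ (hS.subset_edgeSet he)⟩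

lemma expectedMatchingSize_eq [Fintype V] [DecidableEq V] {G : SimpleGraph V}
    (hE : (E : Set (Sym2 V)) = G.edgeSet) (p : ℝ) :
    expectedMatchingSize G p = randomSubsetMean p E fun F => (matchingNumber F : ℝ) := by
  classical
  obtain rfl : G.edgeFinset = E := by rw [← coe_inj, hE, SimpleGraph.coe_edgeFinset]
  simp only [expectedMatchingSize, randomSubsetMean_apply, matchingNumber]
  convert rfl

open scoped Classical in
/-- The edges in `M` that share a vertex with `e`. -/
noncomputable def edgesMeeting (M : Finset (Sym2 V)) (e : Sym2 V) : Finset (Sym2 V) :=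
  {f ∈ M | ∃ v ∈ f, v ∈ e}

lemma mem_edgesMeeting {M : Finset (Sym2 V)} {e f : Sym2 V} :
    f ∈ edgesMeeting M e ↔ f ∈ M ∧ ∃ v ∈ f, v ∈ e := by
  simp [edgesMeeting]

lemma IsMatchingOf.card_edgesMeeting_le {M : Finset (Sym2 V)}
    (hM : IsMatchingOf ⊤ (M : Set (Sym2 V))) (e : Sym2 V) : #(edgesMeeting M e) ≤ 2 := by
  classical
  induction e with | h a b => ?_
  have hsub : edgesMeeting M s(a, b) ⊆ {f ∈ M | a ∈ f} ∪ {f ∈ M | b ∈ f} := fun f hf => by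
    obtain ⟨hfM, v, hvf, hv⟩ := mem_edgesMeeting.1 hf
    rcases Sym2.mem_iff.1 hv with rfl | rfl <;> simp [hfM, hvf]
  have hone : ∀ v, #{f ∈ M | v ∈ f} ≤ 1 := fun v => card_le_one.2 fun f hf g hg =>
    hM.eq_of_mem (mem_filter.1 hf).1 (mem_filter.1 hg).1 (mem_filter.1 hf).2 (mem_filter.1 hg).2
  exact (card_le_card hsub).trans ((card_union_le _ _).trans (add_le_add (hone a) (hone b)))

variable [Finite V]

lemma exists_isMatchingOf_card_eq_matchingNumber (F : Finset (Sym2 V)) :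
    ∃ S ⊆ F, IsMatchingOf ⊤ (S : Set (Sym2 V)) ∧ #S = matchingNumber F := by
  obtain ⟨S, hS, hcard⟩ := exists_isMatchingOf_ncard_eq (SimpleGraph.fromEdgeSet (F : Set (Sym2 V)))
  lift S to Finset (Sym2 V) using S.toFinite
  rw [isMatchingOf_fromEdgeSet_iff, coe_subset] at hS
  exact ⟨S, hS.1, hS.2, by rw [matchingNumber, ← hcard, Set.ncard_coe_finset]⟩

lemma IsMatchingOf.card_le_matchingNumber (hS : IsMatchingOf ⊤ (S : Set (Sym2 V)))
    (hSF : S ⊆ F) : #S ≤ matchingNumber F := by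
  rw [← Set.ncard_coe_finset]
  exact (isMatchingOf_fromEdgeSet_iff.2 ⟨coe_subset.2 hSF, hS⟩).ncard_le

lemma matchingNumber_mono (h : F ⊆ F') : matchingNumber F ≤ matchingNumber F' :=
  maxMatchingSize_mono (SimpleGraph.fromEdgeSet_mono (coe_subset.2 h))

variable [DecidableEq V] {p : ℝ}

lemma matchingNumber_union_le (A B : Finset (Sym2 V)) :
    matchingNumber (A ∪ B) ≤ matchingNumber A + matchingNumber B := by
  obtain ⟨S, hSAB, hS, hcard⟩ := exists_isMatchingOf_card_eq_matchingNumber (A ∪ B)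
  rw [← hcard, ← card_inter_add_card_sdiff S A]
  refine add_le_add (IsMatchingOf.card_le_matchingNumber ?_ inter_subset_right)
    (IsMatchingOf.card_le_matchingNumber ?_ (sdiff_le_iff.2 hSAB))
  exacts [hS.subset (coe_subset.2 inter_subset_left), hS.subset (coe_subset.2 sdiff_subset)]

lemma mean_matchingNumber_union_le (hp : 0 ≤ p) (hp1 : p ≤ 1) {A B : Finset (Sym2 V)}
    (hAB : Disjoint A B) :
    (randomSubsetMean p (A ∪ B) fun F => (matchingNumber F : ℝ)) ≤
      (randomSubsetMean p A fun F => (matchingNumber F : ℝ)) + matchingNumber B := by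
  rw [randomSubsetMean_union hAB, ← randomSubsetMean_const (p := p) (E := A) (matchingNumber B : ℝ),
    ← map_add]
  refine randomSubsetMean_mono hp hp1 fun F₁ _ => ?_
  refine (randomSubsetMean_mono hp hp1 (g := fun _ => (matchingNumber F₁ + matchingNumber B : ℝ))
    fun F₂ hF₂ => ?_).trans (randomSubsetMean_const _).le
  exact_mod_cast (matchingNumber_union_le F₁ F₂).trans
    (Nat.add_le_add_left (matchingNumber_mono hF₂) _)

lemma IsMatchingOf.card_add_card_filter_le {M A B S : Finset (Sym2 V)}
    (hM : IsMatchingOf ⊤ (M : Set (Sym2 V))) (hA : A ⊆ M) (hS : IsMatchingOf ⊤ (S : Set (Sym2 V)))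
    (hSB : S ⊆ B) : #A + #{e ∈ S | Disjoint A (edgesMeeting M e)} ≤ matchingNumber (A ∪ B) := by
  set S' := {e ∈ S | Disjoint A (edgesMeeting M e)}
  have hcov : Disjoint (coveredVertices (A : Set (Sym2 V))) (coveredVertices S') := by
    rw [Set.disjoint_left]
    rintro v ⟨f, hf, hvf⟩ ⟨e, he, hve⟩
    exact disjoint_left.1 (mem_filter.1 he).2 hf (mem_edgesMeeting.2 ⟨hA hf, v, hvf, hve⟩)
  have hdisj : Disjoint A S' := disjoint_left.2 fun f hf hf' =>
    let ⟨v, hv⟩ : ∃ v, v ∈ f := ⟨_, f.out_fst_mem⟩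
    Set.disjoint_left.1 hcov ⟨f, hf, hv⟩ ⟨f, hf', hv⟩
  rw [← card_union_of_disjoint hdisj]
  refine IsMatchingOf.card_le_matchingNumber ?_
    (union_subset_union_right ((filter_subset _ S).trans hSB))
  rw [coe_union]
  exact (hM.subset (coe_subset.2 hA)).union (hS.subset (coe_subset.2 (filter_subset _ S))) hcov

lemma IsMatchingOf.le_mean_matchingNumber_union_const {M : Finset (Sym2 V)}
    (hM : IsMatchingOf ⊤ (M : Set (Sym2 V))) (hp : 0 ≤ p) (hp1 : p ≤ 1) (B : Finset (Sym2 V)) :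
    p * #M + (1 - p) ^ 2 * matchingNumber B ≤
      randomSubsetMean p M fun A => (matchingNumber (A ∪ B) : ℝ) := by
  obtain ⟨S, hSB, hS, hcard⟩ := exists_isMatchingOf_card_eq_matchingNumber B
  have hprob : ∀ e ∈ S, (1 - p) ^ 2 ≤ randomSubsetProb p M (Disjoint · (edgesMeeting M e)) := by
    intro e _
    rw [randomSubsetProb_disjoint]
    exact pow_le_pow_of_le_one (sub_nonneg.2 hp1) (sub_le_self 1 hp)
      ((card_le_card inter_subset_right).trans (hM.card_edgesMeeting_le e))
  calc p * #M + (1 - p) ^ 2 * matchingNumber B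
      = p * #M + ∑ _e ∈ S, (1 - p) ^ 2 := by
        rw [← hcard, sum_const, nsmul_eq_mul, mul_comm _ (#S : ℝ)]
    _ ≤ p * #M + ∑ e ∈ S, randomSubsetProb p M (Disjoint · (edgesMeeting M e)) := by
        gcongr with e he
        exact hprob e he
    _ = randomSubsetMean p M ((fun A => (#A : ℝ)) +
          ∑ e ∈ S, fun A => if Disjoint A (edgesMeeting M e) then 1 else 0) := by
        rw [map_add, map_sum, randomSubsetMean_card]
        simp only [randomSubsetProb_eq]
    _ ≤ randomSubsetMean p M fun A => (matchingNumber (A ∪ B) : ℝ) := by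
        refine randomSubsetMean_mono hp hp1 fun A hA => ?_
        rw [Pi.add_apply, Finset.sum_apply, sum_boole]
        exact_mod_cast hM.card_add_card_filter_le hA hS hSB

lemma IsMatchingOf.le_mean_matchingNumber_union {M Q : Finset (Sym2 V)}
    (hM : IsMatchingOf ⊤ (M : Set (Sym2 V))) (hp : 0 ≤ p) (hp1 : p ≤ 1) (hMQ : Disjoint M Q) :
    p * #M + (1 - p) ^ 2 * (randomSubsetMean p Q fun F => (matchingNumber F : ℝ)) ≤
      randomSubsetMean p (M ∪ Q) fun F => (matchingNumber F : ℝ) := by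
  calc p * #M + (1 - p) ^ 2 * (randomSubsetMean p Q fun F => (matchingNumber F : ℝ))
      = randomSubsetMean p Q
          ((fun _ => p * #M) + (1 - p) ^ 2 • fun F => (matchingNumber F : ℝ)) := by
        rw [map_add, randomSubsetMean_const, map_smul, smul_eq_mul]
    _ ≤ randomSubsetMean p Q fun B => randomSubsetMean p M fun A => (matchingNumber (A ∪ B) : ℝ) :=
        randomSubsetMean_mono hp hp1 fun B _ => hM.le_mean_matchingNumber_union_const hp hp1 B
    _ = randomSubsetMean p (M ∪ Q) fun F => (matchingNumber F : ℝ) := by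
        rw [union_comm, randomSubsetMean_union hMQ.symm]
        simp only [union_comm]

end MatchingNumber

section Tail

variable {V : Type*} {p : ℝ} {F Q : Finset (Sym2 V)}

open scoped Classical in
/-- The edges in `Q` that are not edges of `K`. -/
noncomputable def edgesOutside (Q : Finset (Sym2 V)) (K : SimpleGraph V) : Finset (Sym2 V) :=
  {e ∈ Q | e ∉ K.edgeSet}

lemma mem_edgesOutside {K : SimpleGraph V} {e : Sym2 V} :
    e ∈ edgesOutside Q K ↔ e ∈ Q ∧ e ∉ K.edgeSet := by
  simp [edgesOutside]

lemma one_sub_pow_le_exp_neg_mul {b : ℝ} {n : ℕ} (hp : 0 ≤ p) (hp1 : p ≤ 1) (hb : b ≤ n) :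
    (1 - p) ^ n ≤ Real.exp (-(p * b)) := by
  calc (1 - p) ^ n ≤ Real.exp (-p) ^ n :=
        pow_le_pow_left₀ (sub_nonneg.2 hp1) (Real.one_sub_le_exp_neg p) n
    _ = Real.exp (-(p * n)) := by rw [← Real.exp_nat_mul]; ring_nf
    _ ≤ Real.exp (-(p * b)) := by gcongr

lemma card_biUnion_toFinset_le [DecidableEq V] (Q : Finset (Sym2 V)) :
    #(Q.biUnion Sym2.toFinset) ≤ 2 * #Q := by
  rw [mul_comm]
  refine card_biUnion_le_card_mul _ _ _ fun e _ => ?_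
  rw [Sym2.card_toFinset]
  split_ifs <;> simp

variable [Finite V] [DecidableEq V]

lemma exists_coverGraph_matchingNumber (hF : ∀ e ∈ F, ¬e.IsDiag) (hFQ : F ⊆ Q) :
    ∃ C ∈ ((Q.biUnion Sym2.toFinset).disjSum Q).powerset, #C ≤ 4 * matchingNumber F ∧
      Disjoint F (edgesOutside Q
        (coverGraph C.toLeft (SimpleGraph.fromEdgeSet (C.toRight : Set (Sym2 V))))) ∧
      maxMatchingSize (coverGraph C.toLeft
        (SimpleGraph.fromEdgeSet (C.toRight : Set (Sym2 V)))) ≤ matchingNumber F := by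
  obtain ⟨U, hU, K, hK, hcard, hle, hν⟩ :=
    exists_coverGraph (SimpleGraph.fromEdgeSet (F : Set (Sym2 V)))
  have hedges : (SimpleGraph.fromEdgeSet (F : Set (Sym2 V))).edgeSet = F := by
    rw [SimpleGraph.edgeSet_fromEdgeSet, sdiff_eq_left, Set.disjoint_left]
    exact fun e he => hF e he
  have hKF := hedges ▸ SimpleGraph.edgeSet_mono hK
  lift U to Finset V using U.toFinite
  obtain ⟨E, hE⟩ : ∃ E : Finset (Sym2 V), (E : Set (Sym2 V)) = K.edgeSet :=
    ⟨K.edgeSet.toFinite.toFinset, by simp⟩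
  obtain rfl : SimpleGraph.fromEdgeSet (E : Set (Sym2 V)) = K := by
    rw [hE, SimpleGraph.fromEdgeSet_edgeSet]
  rw [← hE, Set.ncard_coe_finset, Set.ncard_coe_finset] at hcard
  rw [← hE, coe_subset] at hKF
  refine ⟨U.disjSum E, mem_powerset.2 (disjSum_mono (fun v hv => ?_) (hKF.trans hFQ)), ?_, ?_, ?_⟩
  · obtain ⟨w, hvw⟩ := hU hv
    exact mem_biUnion.2 ⟨s(v, w), hFQ (SimpleGraph.fromEdgeSet_adj _ |>.1 hvw).1, by simp⟩
  · rwa [card_disjSum]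
  · rw [toLeft_disjSum, toRight_disjSum, disjoint_left]
    exact fun e he he' => (mem_edgesOutside.1 he').2
      (SimpleGraph.edgeSet_mono hle (hedges.symm ▸ he))
  · rwa [toLeft_disjSum, toRight_disjSum]

/- Every realization with a small maximum matching avoids the many edges of `Q` outside one of the
few graphs `coverGraph U K` with `#U + #K ≤ 4 * a`. -/
lemma randomSubsetProb_matchingNumber_lt_le {a b t : ℝ} (hp : 0 ≤ p) (hp1 : p ≤ 1) (ht : 0 ≤ t)
    (hQ : ∀ e ∈ Q, ¬e.IsDiag)
    (hb : ∀ K : SimpleGraph V, maxMatchingSize K < a → b ≤ #(edgesOutside Q K)) :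
    randomSubsetProb p Q (fun F => (matchingNumber F : ℝ) < a) ≤
      Real.exp (4 * a * t + 3 * Real.exp (-t) * #Q - p * b) := by
  classical
  set W := (Q.biUnion Sym2.toFinset).disjSum Q
  let K (C : Finset (V ⊕ Sym2 V)) : SimpleGraph V :=
    coverGraph C.toLeft (SimpleGraph.fromEdgeSet (C.toRight : Set (Sym2 V)))
  let I := {C ∈ W.powerset | (#C : ℝ) ≤ 4 * a ∧ maxMatchingSize (K C) < a}
  have hW : (#W : ℝ) ≤ 3 * #Q := by
    have := card_biUnion_toFinset_le Q
    rw [card_disjSum]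
    norm_cast
    omega
  have hcover : ∀ F ⊆ Q, (matchingNumber F : ℝ) < a →
      ∃ C ∈ I, Disjoint F (edgesOutside Q (K C)) := fun F hFQ hFa => by
    obtain ⟨C, hCW, hcard, hdisj, hle⟩ :=
      exists_coverGraph_matchingNumber (fun e he => hQ e (hFQ he)) hFQ
    have hcard' : (#C : ℝ) ≤ 4 * matchingNumber F := by exact_mod_cast hcard
    exact ⟨C, mem_filter.2 ⟨hCW, by linarith, (Nat.cast_le.2 hle).trans_lt hFa⟩, hdisj⟩
  calc randomSubsetProb p Q (fun F => (matchingNumber F : ℝ) < a)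
      ≤ ∑ C ∈ I, randomSubsetProb p Q (Disjoint · (edgesOutside Q (K C))) :=
        randomSubsetProb_le_sum hp hp1 hcover
    _ ≤ ∑ _ ∈ I, Real.exp (-(p * b)) := by
        refine sum_le_sum fun C hC => ?_
        rw [randomSubsetProb_disjoint, inter_eq_right.2 fun e he => (mem_edgesOutside.1 he).1]
        exact one_sub_pow_le_exp_neg_mul hp hp1 (hb (K C) (mem_filter.1 hC).2.2)
    _ ≤ #{C ∈ W.powerset | (#C : ℝ) ≤ 4 * a} * Real.exp (-(p * b)) := by
        rw [sum_const, nsmul_eq_mul]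
        gcongr
        exact fun _ hC => mem_filter.2 ⟨(mem_filter.1 hC).1, (mem_filter.1 hC).2.1⟩
    _ ≤ Real.exp (t * (4 * a) + Real.exp (-t) * (3 * #Q)) * Real.exp (-(p * b)) := by
        gcongr
        refine (card_filter_powerset_card_le W (4 * a) ht).trans ?_
        gcongr
    _ = Real.exp (4 * a * t + 3 * Real.exp (-t) * #Q - p * b) := by
        rw [← Real.exp_add]
        ring_nf

end Tail

section Rounds

variable {C ε p : ℝ}

lemma one_le_log_one_div {x : ℝ} (hx : 0 < x) (hx' : x ≤ 1 / 3) : 1 ≤ Real.log (1 / x) := by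
  rw [Real.le_log_iff_exp_le (by positivity), le_div_iff₀ hx]
  nlinarith [Real.exp_one_lt_three]

lemma one_le_log_one_div_mul (hε : 0 < ε) (hε' : ε ≤ 1 / 3) (hp : 0 < p) (hp1 : p ≤ 1) :
    1 ≤ Real.log (1 / (ε * p)) :=
  one_le_log_one_div (by positivity) (mul_le_of_le_one_right hε.le hp1 |>.trans hε')

lemma le_matchingCoverRounds (C ε p : ℝ) :
    C * (Real.log (1 / (ε * p)) / (ε * p)) ≤ matchingCoverRounds C ε p :=
  Nat.le_ceil _

lemma one_le_mul_log_one_div_div (hC : 1 ≤ C) (hε : 0 < ε) (hε' : ε ≤ 1 / 3) (hp : 0 < p)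
    (hp1 : p ≤ 1) : 1 ≤ C * (Real.log (1 / (ε * p)) / (ε * p)) := by
  have hlog := one_le_log_one_div_mul hε hε' hp hp1
  refine one_le_mul_of_one_le_of_one_le hC ((one_le_div (by positivity)).2 ?_)
  nlinarith

lemma matchingCoverRounds_le (hC : 1 ≤ C) (hε : 0 < ε) (hε' : ε ≤ 1 / 3) (hp : 0 < p)
    (hp1 : p ≤ 1) :
    matchingCoverRounds C ε p ≤ 2 * (C * (Real.log (1 / (ε * p)) / (ε * p))) := by
  have hone := one_le_mul_log_one_div_div hC hε hε' hp hp1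
  have hceil := Nat.ceil_lt_add_one (zero_le_one.trans hone)
  rw [matchingCoverRounds]
  linarith

lemma one_le_matchingCoverRounds (hC : 1 ≤ C) (hε : 0 < ε) (hε' : ε ≤ 1 / 3) (hp : 0 < p)
    (hp1 : p ≤ 1) : 1 ≤ matchingCoverRounds C ε p :=
  Nat.one_le_cast.1 ((one_le_mul_log_one_div_div hC hε hε' hp hp1).trans
    (le_matchingCoverRounds C ε p))

lemma log_two_mul_le {x : ℝ} (hx : 0 < x) : Real.log (2 * x) ≤ x / 128 + 5 := by
  have hsplit : Real.log (2 * x) = 8 * Real.log 2 + Real.log (x / 128) := by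
    rw [← Nat.cast_ofNat (n := 8), ← Real.log_pow, ← Real.log_mul (by norm_num) (by positivity)]
    ring_nf
  linarith [Real.log_two_lt_d9, Real.log_le_sub_one_of_pos (show 0 < x / 128 by positivity)]

lemma log_matchingCoverRounds_div_le (hC : 1 ≤ C) (hε : 0 < ε) (hε' : ε ≤ 1 / 3) (hp : 0 < p)
    (hp1 : p ≤ 1) :
    Real.log (matchingCoverRounds C ε p / p) ≤ C / 128 + 4 + 3 * Real.log (1 / (ε * p)) := by
  have hR := one_le_matchingCoverRounds hC hε hε' hp hp1
  have hl := one_le_log_one_div_mul hε hε' hp hp1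
  set l := Real.log (1 / (ε * p)) with hl_def
  have hlog_p : Real.log (1 / p) ≤ l :=
    Real.log_le_log (by positivity) (one_div_le_one_div_of_le (by positivity) (by nlinarith))
  calc Real.log (matchingCoverRounds C ε p / p)
      ≤ Real.log (2 * (C * (l / (ε * p))) / p) := by
        gcongr
        exact matchingCoverRounds_le hC hε hε' hp hp1
    _ = Real.log (2 * C) + Real.log l + l + Real.log (1 / p) := by
        rw [hl_def, ← Real.log_mul (by positivity) (by positivity),
          ← Real.log_mul (by positivity) (by positivity),
          ← Real.log_mul (by positivity) (by positivity)]
        ring_nf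
    _ ≤ C / 128 + 4 + 3 * l := by
        linarith [log_two_mul_le (zero_lt_one.trans_le hC),
          Real.log_le_sub_one_of_pos (zero_lt_one.trans_le hl)]

/- The left-hand side is the exponent in `randomSubsetProb_matchingNumber_lt_le` for `a = T`,
`t = log (R / p)`, `b = R * max 1 (ε * T)` and at most `R * T / p` edges, where `R` is the number
of rounds. -/
lemma matchingCoverRounds_exponent_le {T : ℝ} (hC : 100 ≤ C) (hε : 0 < ε) (hε' : ε ≤ 1 / 3)
    (hp : 0 < p) (hp1 : p ≤ 1) (hT : 0 ≤ T) :
    4 * T * Real.log (matchingCoverRounds C ε p / p) + 3 * T -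
      p * (matchingCoverRounds C ε p * max 1 (ε * T)) ≤ Real.log (ε * p) := by
  have hlog := log_matchingCoverRounds_div_le (C := C) (by linarith) hε hε' hp hp1
  have hl := one_le_log_one_div_mul hε hε' hp hp1
  have hR := le_matchingCoverRounds C ε p
  have hneg : Real.log (ε * p) = -Real.log (1 / (ε * p)) := by rw [one_div, Real.log_inv, neg_neg]
  rw [hneg]
  set l := Real.log (1 / (ε * p))
  have hmax : ε * ((T + 1) / 2) ≤ max 1 (ε * T) := by
    linarith [le_max_left 1 (ε * T), le_max_right 1 (ε * T)]
  have hcover : C * l * ((T + 1) / 2) ≤ p * (matchingCoverRounds C ε p * max 1 (ε * T)) := by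
    calc C * l * ((T + 1) / 2) = p * (C * (l / (ε * p)) * (ε * ((T + 1) / 2))) := by field_simp
      _ ≤ p * (matchingCoverRounds C ε p * max 1 (ε * T)) := by gcongr
  have hconst : 4 * (C / 128 + 4 + 3 * l) + 3 ≤ C * l / 2 := by nlinarith
  nlinarith [mul_le_mul_of_nonneg_left hlog hT, mul_le_mul_of_nonneg_left hconst hT]

end Rounds

section MatchingCoverLemma

variable {V : Type*} [Finite V]

lemma IsMatchingOf.card_le_add_card_edgesOutside {S : Finset (Sym2 V)}
    (hS : IsMatchingOf ⊤ (S : Set (Sym2 V))) (K : SimpleGraph V) :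
    #S ≤ maxMatchingSize K + #(edgesOutside S K) := by
  classical
  have hSK : IsMatchingOf K ({e ∈ S | e ∈ K.edgeSet} : Finset (Sym2 V)) :=
    hS.of_subset (coe_subset.2 (filter_subset _ _)) fun e he => (mem_filter.1 he).2
  have hsplit := card_filter_add_card_filter_not (s := S) (· ∈ K.edgeSet)
  have hle := hSK.ncard_le
  rw [Set.ncard_coe_finset] at hle
  simp only [edgesOutside]
  convert hsplit.ge.trans (Nat.add_le_add_right hle _)

variable [DecidableEq V] {ι : Type*} [Fintype ι] {N : ι → Finset (Sym2 V)} {L : ℕ}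

lemma card_mul_max_le_card_edgesOutside_biUnion (hN : ∀ i, IsMatchingOf ⊤ (N i : Set (Sym2 V)))
    (hdisj : Pairwise fun i j => Disjoint (N i) (N j)) (hL : ∀ i, L ≤ #(N i)) {s : ℝ} (hs : 0 ≤ s)
    {K : SimpleGraph V} (hK : maxMatchingSize K < L - s) :
    Fintype.card ι * max 1 s ≤ #(edgesOutside (univ.biUnion N) K) := by
  have hround : ∀ i, max 1 s ≤ #(edgesOutside (N i) K) := fun i => by
    have hLi : (L : ℝ) ≤ maxMatchingSize K + #(edgesOutside (N i) K) := by
      exact_mod_cast (hL i).trans ((hN i).card_le_add_card_edgesOutside K)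
    have hpos : 0 < #(edgesOutside (N i) K) := Nat.cast_pos (α := ℝ) |>.1 (by linarith)
    exact max_le (by exact_mod_cast hpos) (by linarith)
  have hsum : Fintype.card ι * max 1 s ≤ ∑ i, (#(edgesOutside (N i) K) : ℝ) := by
    simpa using card_nsmul_le_sum univ _ _ fun i _ => hround i
  refine hsum.trans_eq ?_
  classical
  rw [edgesOutside, filter_biUnion, card_biUnion fun i _ j _ hij =>
    disjoint_filter_filter (hdisj hij)]
  push_cast
  simp only [edgesOutside]

lemma randomSubsetProb_matchingNumber_biUnion_lt_le {p a s t : ℝ} (hp : 0 ≤ p) (hp1 : p ≤ 1)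
    (ht : 0 ≤ t) (hs : 0 ≤ s) (ha : a ≤ L - s) (hN : ∀ i, IsMatchingOf ⊤ (N i : Set (Sym2 V)))
    (hdisj : Pairwise fun i j => Disjoint (N i) (N j)) (hL : ∀ i, L ≤ #(N i)) :
    randomSubsetProb p (univ.biUnion N) (fun F => (matchingNumber F : ℝ) < a) ≤
      Real.exp (4 * a * t + 3 * Real.exp (-t) * #(univ.biUnion N) -
        p * (Fintype.card ι * max 1 s)) := by
  refine randomSubsetProb_matchingNumber_lt_le hp hp1 ht (fun e he => ?_) fun K hK =>
    card_mul_max_le_card_edgesOutside_biUnion hN hdisj hL hs (hK.trans_le ha)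
  obtain ⟨i, -, hi⟩ := mem_biUnion.1 he
  exact SimpleGraph.not_isDiag_of_mem_edgeSet _ ((hN i).subset_edgeSet hi)

variable {C ε p T : ℝ} {m : ℕ} {N : Fin (matchingCoverRounds C ε p) → Finset (Sym2 V)}

lemma randomSubsetProb_matchingNumber_biUnion_matchingCover_lt_le (hC : 100 ≤ C) (hε : 0 < ε)
    (hε' : ε ≤ 1 / 3) (hp : 0 < p) (hp1 : p ≤ 1) (hmT : p * m ≤ T)
    (hN : ∀ i, IsMatchingOf ⊤ (N i : Set (Sym2 V)))
    (hdisj : Pairwise fun i j => Disjoint (N i) (N j)) (hL : ∀ i, L ≤ #(N i))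
    (hm : ∀ i, #(N i) ≤ m) :
    randomSubsetProb p (univ.biUnion N)
      (fun F => (matchingNumber F : ℝ) < min (L : ℝ) T - ε * T) ≤ ε * p := by
  have hT : 0 ≤ T := le_trans (by positivity) hmT
  have hR : (1 : ℝ) ≤ matchingCoverRounds C ε p :=
    Nat.one_le_cast.2 (one_le_matchingCoverRounds (by linarith) hε hε' hp hp1)
  have hexp := matchingCoverRounds_exponent_le hC hε hε' hp hp1 hT
  have hcard : (#(univ.biUnion N) : ℝ) ≤ matchingCoverRounds C ε p * m := by
    exact_mod_cast (card_biUnion_le_card_mul univ N m fun i _ => hm i).trans_eq (by simp)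
  have hlog : 0 ≤ Real.log (matchingCoverRounds C ε p / p) :=
    Real.log_nonneg ((one_le_div hp).2 (hp1.trans hR))
  have htail := randomSubsetProb_matchingNumber_biUnion_lt_le hp.le hp1 hlog (by positivity)
    (sub_le_sub_right (min_le_left (L : ℝ) T) (ε * T)) hN hdisj hL
  rw [Fintype.card_fin] at htail
  set R := (matchingCoverRounds C ε p : ℝ)
  refine htail.trans ?_
  rw [← Real.exp_log (show 0 < ε * p by positivity), Real.exp_le_exp]
  have hle_T : min (L : ℝ) T - ε * T ≤ T :=
    (sub_le_self _ (by positivity)).trans (min_le_right _ _)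
  have hedges : 3 * Real.exp (-Real.log (R / p)) * #(univ.biUnion N) ≤ 3 * T := by
    calc 3 * Real.exp (-Real.log (R / p)) * #(univ.biUnion N) ≤ 3 * (p / R) * (R * m) := by
          rw [← Real.log_inv, inv_div, Real.exp_log (by positivity)]
          gcongr
      _ = 3 * (p * m) := by field_simp
      _ ≤ 3 * T := by gcongr
  linarith [mul_le_mul_of_nonneg_right hle_T hlog]

theorem min_sub_le_mean_matchingNumber_biUnion_matchingCover (hC : 100 ≤ C) (hε : 0 < ε)
    (hε' : ε ≤ 1 / 3) (hp : 0 < p) (hp1 : p ≤ 1) (hmT : p * m ≤ T)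
    (hN : ∀ i, IsMatchingOf ⊤ (N i : Set (Sym2 V)))
    (hdisj : Pairwise fun i j => Disjoint (N i) (N j)) (hL : ∀ i, L ≤ #(N i))
    (hm : ∀ i, #(N i) ≤ m) :
    min (L : ℝ) T - 2 * ε * T ≤
      randomSubsetMean p (univ.biUnion N) fun F => (matchingNumber F : ℝ) := by
  have hT : 0 ≤ T := le_trans (by positivity) hmT
  have hmean := mul_one_sub_randomSubsetProb_lt_le hp.le hp1 (E := univ.biUnion N)
    (fun F _ => Nat.cast_nonneg (matchingNumber F)) (min (L : ℝ) T - ε * T)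
  have hprob := randomSubsetProb_matchingNumber_biUnion_matchingCover_lt_le hC hε hε' hp hp1 hmT
    hN hdisj hL hm
  have hle_T : min (L : ℝ) T - ε * T ≤ T :=
    (sub_le_self _ (by positivity)).trans (min_le_right _ _)
  set a := min (L : ℝ) T - ε * T
  rcases le_or_gt a 0 with ha | ha
  · have hnonneg : 0 ≤ randomSubsetMean p (univ.biUnion N) fun F => (matchingNumber F : ℝ) :=
      randomSubsetMean_nonneg hp.le hp1 fun F _ => Nat.cast_nonneg _
    linarith [mul_nonneg hε.le hT]
  · have hloss : a * randomSubsetProb p (univ.biUnion N) (fun F => (matchingNumber F : ℝ) < a) ≤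
        T * ε :=
      (mul_le_mul_of_nonneg_left (hprob.trans (mul_le_of_le_one_right hε.le hp1)) ha.le).trans
        (mul_le_mul_of_nonneg_right hle_T hε.le)
    linarith

end MatchingCoverLemma

section ExpectedMatchingSize

variable {V : Type*} [Fintype V] {G H : SimpleGraph V} {M : Set (Sym2 V)} {p : ℝ}

lemma expectedMatchingSize_nonneg (hp : 0 ≤ p) (hp1 : p ≤ 1) : 0 ≤ expectedMatchingSize G p := by
  classical
  rw [expectedMatchingSize_eq G.coe_edgeFinset]
  exact randomSubsetMean_nonneg hp hp1 fun F _ => Nat.cast_nonneg _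

lemma expectedMatchingSize_le_maxMatchingSize (hp : 0 ≤ p) (hp1 : p ≤ 1) :
    expectedMatchingSize G p ≤ maxMatchingSize G := by
  classical
  rw [expectedMatchingSize_eq G.coe_edgeFinset]
  refine (randomSubsetMean_mono (g := fun _ => (maxMatchingSize G : ℝ)) hp hp1 fun F hF =>
    Nat.cast_le.2 (maxMatchingSize_mono ?_)).trans (randomSubsetMean_const _).le
  exact (SimpleGraph.fromEdgeSet_mono (coe_subset.2 hF)).trans_eq (by simp)

lemma expectedMatchingSize_le_add_maxMatchingSize_sdiff (hp : 0 ≤ p) (hp1 : p ≤ 1) (h : H ≤ G) :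
    expectedMatchingSize G p ≤ expectedMatchingSize H p + maxMatchingSize (G \ H) := by
  classical
  have hdisj : Disjoint H.edgeFinset (G \ H).edgeFinset :=
    SimpleGraph.disjoint_edgeFinset.2 disjoint_sdiff_self_right
  have hG : ((H.edgeFinset ∪ (G \ H).edgeFinset : Finset (Sym2 V)) : Set (Sym2 V)) = G.edgeSet := by
    rw [← SimpleGraph.edgeFinset_sup, SimpleGraph.coe_edgeFinset, sup_sdiff_cancel_right h]
  have hν : matchingNumber (G \ H).edgeFinset = maxMatchingSize (G \ H) := by
    rw [matchingNumber, SimpleGraph.coe_edgeFinset, SimpleGraph.fromEdgeSet_edgeSet]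
  rw [expectedMatchingSize_eq hG, expectedMatchingSize_eq H.coe_edgeFinset, ← hν]
  exact mean_matchingNumber_union_le hp hp1 hdisj

lemma IsMatchingOf.le_expectedMatchingSize_sup (hM : IsMatchingOf G M) (hp : 0 ≤ p) (hp1 : p ≤ 1)
    (hMH : Disjoint M H.edgeSet) :
    p * M.ncard + (1 - p) ^ 2 * expectedMatchingSize H p ≤
      expectedMatchingSize (SimpleGraph.fromEdgeSet M ⊔ H) p := by
  classical
  lift M to Finset (Sym2 V) using M.toFinite
  have hdiag : Disjoint (M : Set (Sym2 V)) Sym2.diagSet := Set.disjoint_left.2 fun e he =>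
    G.not_isDiag_of_mem_edgeSet (hM.subset_edgeSet he)
  have hsup : ((M ∪ H.edgeFinset : Finset (Sym2 V)) : Set (Sym2 V)) =
      (SimpleGraph.fromEdgeSet (M : Set (Sym2 V)) ⊔ H).edgeSet := by
    rw [SimpleGraph.edgeSet_sup, SimpleGraph.edgeSet_fromEdgeSet, coe_union,
      SimpleGraph.coe_edgeFinset, hdiag.sdiff_eq_left]
  rw [Set.ncard_coe_finset, expectedMatchingSize_eq hsup, expectedMatchingSize_eq H.coe_edgeFinset]
  refine (hM.mono le_top).le_mean_matchingNumber_union hp hp1 ?_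
  rwa [← disjoint_coe, SimpleGraph.coe_edgeFinset]

lemma mul_maxMatchingSize_le_expectedMatchingSize (hp : 0 ≤ p) (hp1 : p ≤ 1) :
    p * maxMatchingSize G ≤ expectedMatchingSize G p := by
  obtain ⟨M, hM, hcard⟩ := exists_isMatchingOf_ncard_eq G
  have hG : SimpleGraph.fromEdgeSet M ⊔ G.deleteEdges M = G := by
    rw [SimpleGraph.deleteEdges, sup_sdiff_cancel_right]
    exact (SimpleGraph.fromEdgeSet_mono hM.subset_edgeSet).trans_eq G.fromEdgeSet_edgeSet
  have hdisj : Disjoint M (G.deleteEdges M).edgeSet := by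
    rw [SimpleGraph.edgeSet_deleteEdges]
    exact disjoint_sdiff_self_right
  have hle := hM.le_expectedMatchingSize_sup hp hp1 hdisj
  rw [hG, hcard] at hle
  linarith [mul_nonneg (sq_nonneg (1 - p))
    (expectedMatchingSize_nonneg (G := G.deleteEdges M) hp hp1)]

end ExpectedMatchingSize

namespace IsMatchingCover

variable {V : Type*} {G : SimpleGraph V} {R : ℕ} {N : Fin R → Set (Sym2 V)}

lemma isMatchingOf (h : IsMatchingCover G R N) (i : Fin R) : IsMatchingOf G (N i) :=
  (h i).1.mono (SimpleGraph.deleteEdges_le _)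

lemma iUnion_subset_edgeSet (h : IsMatchingCover G R N) : ⋃ i, N i ⊆ G.edgeSet :=
  Set.iUnion_subset fun i => (h.isMatchingOf i).subset_edgeSet

lemma pairwise_disjoint (h : IsMatchingCover G R N) :
    Pairwise fun i j => Disjoint (N i) (N j) := by
  have hlt : ∀ i j, i < j → Disjoint (N i) (N j) := fun i j hij =>
    Set.disjoint_left.2 fun e hei hej => by
      have := (h j).1.subset_edgeSet hej
      rw [SimpleGraph.edgeSet_deleteEdges] at this
      exact this.2 (Set.mem_iUnion₂.2 ⟨i, hij, hei⟩)
  exact fun i j hij => hij.lt_or_gt.elim (hlt i j) fun hji => (hlt j i hji).symm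

variable [Finite V]

lemma maxMatchingSize_deleteEdges_le (h : IsMatchingCover G R N) (i : Fin R) :
    maxMatchingSize (G.deleteEdges (⋃ j, N j)) ≤ (N i).ncard := by
  rw [(h i).ncard_eq]
  exact maxMatchingSize_mono (SimpleGraph.deleteEdges_anti
    (Set.iUnion_mono fun j => Set.iUnion_subset fun _ => Set.Subset.rfl))

end IsMatchingCover

section MainTheorem

variable {V : Type*} [Fintype V] {C ε p : ℝ} {G : SimpleGraph V}

theorem IsMatchingCover.min_sub_le_expectedMatchingSize {T : ℝ} (hC : 100 ≤ C) (hε : 0 < ε)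
    (hε' : ε ≤ 1 / 3) (hp : 0 < p) (hp1 : p ≤ 1)
    {N : Fin (matchingCoverRounds C ε p) → Set (Sym2 V)} (hN : IsMatchingCover G _ N)
    (hT : p * maxMatchingSize G ≤ T) :
    min (maxMatchingSize (G.deleteEdges (⋃ i, N i)) : ℝ) T - 2 * ε * T ≤
      expectedMatchingSize (SimpleGraph.fromEdgeSet (⋃ i, N i)) p := by
  classical
  lift N to Fin (matchingCoverRounds C ε p) → Finset (Sym2 V) using fun i => (N i).toFinite
  have hE : (univ.biUnion N : Set (Sym2 V)) =
      (SimpleGraph.fromEdgeSet (⋃ i, (N i : Set (Sym2 V)))).edgeSet := by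
    rw [SimpleGraph.edgeSet_fromEdgeSet, sdiff_eq_left.2]
    · simp
    · exact Set.disjoint_left.2 fun e he =>
        G.not_isDiag_of_mem_edgeSet (hN.iUnion_subset_edgeSet he)
  have hL := hN.maxMatchingSize_deleteEdges_le
  have hm := fun i => (hN.isMatchingOf i).ncard_le
  simp only [Set.ncard_coe_finset] at hL hm
  rw [expectedMatchingSize_eq hE]
  exact min_sub_le_mean_matchingNumber_biUnion_matchingCover hC hε hε' hp hp1 hT
    (fun i => (hN.isMatchingOf i).mono le_top)
    (fun i j hij => disjoint_coe.1 (hN.pairwise_disjoint hij)) hL hm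

lemma half_add_sq_sub_le (hp : 0 ≤ p) (hε : 0 ≤ ε) (hε' : ε ≤ 1 / 3) :
    1 / 2 + p ^ 2 / 4 - ε ≤ p + (1 - p) ^ 2 * (1 - 2 * ε) := by
  have h₀ : 0 ≤ 1 / 2 - p + 3 * p ^ 2 / 4 := by nlinarith [sq_nonneg (3 * p - 2)]
  have h₁ : 0 ≤ 1 / 6 + p / 3 + p ^ 2 / 12 := by positivity
  have hε'' : 0 ≤ 1 - 3 * ε := by linarith
  linear_combination (1 - 3 * ε) * h₀ + 3 * ε * h₁

lemma one_add_sq_mul_half_add_sq_sub_le (hp : 0 ≤ p) (hp1 : p ≤ 1) (hε : 0 ≤ ε) :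
    (1 + (1 - p) ^ 2) * (1 / 2 + p ^ 2 / 4 - ε) ≤ p + (1 - p) ^ 2 * (1 - 2 * ε) := by
  have hq : 0 ≤ 1 - (1 - p) ^ 2 := by nlinarith
  linear_combination (p ^ 2 / 4 + ε) * hq

/- Here `T`, `Y` and `B` stand for the expected matching sizes of `G`, of the output and of the
matching cover, `m` for the size of `M`, and `L` for that of a maximum matching of the edges left
over. -/
lemma half_add_sq_sub_mul_le {T Y L B m : ℝ} (hp : 0 ≤ p) (hp1 : p ≤ 1) (hε : 0 ≤ ε)
    (hε' : ε ≤ 1 / 3) (hT : 0 ≤ T) (hTm : T ≤ m) (hB : min L T - 2 * ε * T ≤ B) (hL : T ≤ Y + L)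
    (hY : p * m + (1 - p) ^ 2 * B ≤ Y) : (1 / 2 + p ^ 2 / 4 - ε) * T ≤ Y := by
  have hmin : p * T + (1 - p) ^ 2 * (min L T - 2 * ε * T) ≤ Y := le_trans (by gcongr) hY
  rcases le_total L T with h | h
  · rw [min_eq_left h] at hmin
    refine le_of_mul_le_mul_left ?_ (by positivity : 0 < 1 + (1 - p) ^ 2)
    have hratio := one_add_sq_mul_half_add_sq_sub_le hp hp1 hε
    linear_combination hratio * T + (1 - p) ^ 2 * hL + hmin
  · rw [min_eq_right h] at hmin
    linear_combination half_add_sq_sub_le hp hε hε' * T + hmin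

theorem mainTheorem4_general (hC : 100 ≤ C) (hε : 0 < ε) (hε' : ε ≤ 1 / 3) (hp : 0 < p)
    (hp1 : p ≤ 1) {M : Set (Sym2 V)} {N : Fin (matchingCoverRounds C ε p) → Set (Sym2 V)}
    (hM : IsMaximumMatchingOf G M) (hN : IsMatchingCover (G.deleteEdges M) _ N) :
    (1 / 2 + p ^ 2 / 4 - ε) * expectedMatchingSize G p ≤
      expectedMatchingSize (SimpleGraph.fromEdgeSet (M ∪ ⋃ i, N i)) p := by
  have hNM : ⋃ i, N i ⊆ G.edgeSet \ M :=
    hN.iUnion_subset_edgeSet.trans_eq (SimpleGraph.edgeSet_deleteEdges M)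
  have hHG : SimpleGraph.fromEdgeSet (M ∪ ⋃ i, N i) ≤ G :=
    (SimpleGraph.fromEdgeSet_mono (Set.union_subset hM.1.subset_edgeSet
      (hNM.trans Set.sdiff_subset))).trans_eq G.fromEdgeSet_edgeSet
  have hMN : Disjoint M (SimpleGraph.fromEdgeSet (⋃ i, N i)).edgeSet := by
    rw [SimpleGraph.edgeSet_fromEdgeSet]
    exact Set.disjoint_left.2 fun e heM heN => (hNM heN.1).2 heM
  have hT : p * maxMatchingSize (G.deleteEdges M) ≤ expectedMatchingSize G p :=
    (mul_le_mul_of_nonneg_left (Nat.cast_le.2 (maxMatchingSize_mono (G.deleteEdges_le M)))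
      hp.le).trans (mul_maxMatchingSize_le_expectedMatchingSize hp.le hp1)
  have hcover := hN.min_sub_le_expectedMatchingSize hC hε hε' hp hp1 hT
  have hrest := expectedMatchingSize_le_add_maxMatchingSize_sdiff hp.le hp1 hHG
  have hsup := hM.1.le_expectedMatchingSize_sup hp.le hp1 hMN
  rw [SimpleGraph.deleteEdges_deleteEdges, SimpleGraph.deleteEdges] at hcover
  rw [SimpleGraph.fromEdgeSet_union] at hcover hrest ⊢
  rw [hM.ncard_eq] at hsup
  exact half_add_sq_sub_mul_le hp.le hp1 hε.le hε' (expectedMatchingSize_nonneg hp.le hp1)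
    (expectedMatchingSize_le_maxMatchingSize hp.le hp1) hcover hrest hsup

end MainTheorem

theorem mainTheorem4 :
    ∃ C₀ : ℝ, 0 < C₀ ∧ ∀ C : ℝ, C₀ ≤ C →
      ∀ p₀ p : ℝ, 0 < p₀ → p₀ ≤ p → p ≤ 1 →
        ∀ (V : Type*) [Fintype V] (G H : SimpleGraph V),
          IsAlgorithmOutput C p₀ p G H →
            (1 / 2 + p ^ 2 / 4 - p₀ ^ 2 / 10 ^ 4) * expectedMatchingSize G p ≤
              expectedMatchingSize H p := by
  refine ⟨100, by norm_num, fun C hC p₀ p hp₀ hp₀p hp1 V _ G H ⟨M, N, hM, hN, hH⟩ => ?_⟩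
  subst hH
  exact mainTheorem4_general hC (by positivity) (by nlinarith) (hp₀.trans_le hp₀p) hp1 hM hN
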